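/- For $\xi\in\mathbb R$ and $a\in\mathbb C$ with $\Re(a)>-1$ and $\Re(a)\neq 0$, the integral $$J(a,\xi)=\int_{-\infty}^{\infty}\Gamma(a-it)\,\Gamma(a+it)\,e^{-it\xi}\,dt$$ converges absolutely. For every real $\xi$ and every purely imaginary $p\neq 0$, the two limits below exist (with $a$ tending to $p$ in the open right, respectively left, half-plane), and the jump of $J(\cdot,\xi)$ across the imaginary axis at $p$ is $$[[J(p,\xi)]]:=\lim_{\substack{a\to p\\ \Re(a)>0}}J(a,\xi)-\lim_{\substack{a\to p\\ \Re(a)<0}}J(a,\xi)=4\pi\cosh(p\xi)\,\Gamma(2p).$$ -/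

import Mathlib

open Filter Topology MeasureTheory

noncomputable section

/-- The function `t ↦ Γ(a - it) Γ(a + it) e^{-itξ}` of the real variable `t`. -/
def gammaIntegrand (a : ℂ) (ξ : ℝ) (t : ℝ) : ℂ :=
  Complex.Gamma (a - Complex.I * t) * Complex.Gamma (a + Complex.I * t) *
    Complex.exp (-(Complex.I * t * ξ))

/-- `J(a, ξ) = ∫ Γ(a - it) Γ(a + it) e^{-itξ} dt` over the real line. -/
def J (a : ℂ) (ξ : ℝ) : ℂ :=
  ∫ t : ℝ, gammaIntegrand a ξ t

/-- The two one-sided limits of `f` at `p`, from the open right and from the open left half-plane,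
exist, and the right one minus the left one is `j`. For `p` on the imaginary axis these
limits are unique, and so is `j`. -/
def HasJumpAcrossImaginaryAxis (f : ℂ → ℂ) (p j : ℂ) : Prop :=
  ∃ Lright Lleft : ℂ,
    Tendsto f (𝓝[{a : ℂ | 0 < a.re}] p) (𝓝 Lright) ∧
    Tendsto f (𝓝[{a : ℂ | a.re < 0}] p) (𝓝 Lleft) ∧
    Lright - Lleft = j

end

/-!
The functional equation turns `Γ(a - it) Γ(a + it)` into `Γ(b - it) Γ(b + it) / (a² + t²)` with
`b = a + 1`, where `0 < re b` also to the left of the imaginary axis. The beta integral exhibits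
`Γ(b - it) Γ(b + it)` as `Γ(2b)` times the Fourier transform of `w(s) = (2 cosh (s / 2)) ^ (-2b)`,
and `1 / (α² + t²)` has Fourier transform `(π / α) e^{-α|u|}` when `0 < re α`. Hence, by Fubini,
`J(a, ξ) = G(α) = Γ(2b) (π / α) ∫ w(s) e^{-α|s - ξ|} ds`, where `α` is whichever of `a` and `-a`
has positive real part. The integral `G` is continuous in `α` across the imaginary axis, so the jump
is `G(p) - G(-p)`; there `e^{-p|x|} + e^{p|x|} = e^{px} + e^{-px}` removes the absolute values, and
what is left is again a beta integral.
-/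

section

open Complex
open scoped FourierTransform Real

lemma sq_add_sq_eq_sub_I_mul_mul_add_I_mul (a : ℂ) (t : ℝ) :
    a ^ 2 + (t : ℂ) ^ 2 = (a - I * t) * (a + I * t) := by
  linear_combination (t : ℂ) ^ 2 * I_sq

lemma add_I_mul_ne_zero {a : ℂ} (ha : a.re ≠ 0) (t : ℝ) : a + I * t ≠ 0 :=
  fun h => ha (by simpa using congrArg re h)

lemma sub_I_mul_ne_zero {a : ℂ} (ha : a.re ≠ 0) (t : ℝ) : a - I * t ≠ 0 :=
  fun h => ha (by simpa using congrArg re h)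

lemma sq_add_sq_ne_zero {a : ℂ} (ha : a.re ≠ 0) (t : ℝ) : a ^ 2 + (t : ℂ) ^ 2 ≠ 0 := by
  rw [sq_add_sq_eq_sub_I_mul_mul_add_I_mul]
  exact mul_ne_zero (sub_I_mul_ne_zero ha t) (add_I_mul_ne_zero ha t)

lemma one_add_abs_le_mul_norm_add_I_mul {a : ℂ} (ha : a.re ≠ 0) (t : ℝ) :
    1 + |t| ≤ (1 + (1 + ‖a‖) / |a.re|) * ‖a + I * t‖ := by
  have hre : |a.re| ≤ ‖a + I * t‖ := by simpa using abs_re_le_norm (a + I * t)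
  have ht : |t| ≤ ‖a + I * t‖ + ‖a‖ := by simpa using norm_sub_le (a + I * t) a
  have hone : 1 + ‖a‖ ≤ (1 + ‖a‖) / |a.re| * ‖a + I * t‖ := by
    rw [div_mul_eq_mul_div, le_div_iff₀ (abs_pos.2 ha)]
    gcongr
  linarith

lemma one_add_sq_le_mul_norm_sq_add_sq {a : ℂ} (ha : a.re ≠ 0) (t : ℝ) :
    1 + t ^ 2 ≤ (1 + (1 + ‖a‖) / |a.re|) ^ 2 * ‖a ^ 2 + (t : ℂ) ^ 2‖ := by
  have hadd := one_add_abs_le_mul_norm_add_I_mul ha t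
  have hsub := one_add_abs_le_mul_norm_add_I_mul ha (-t)
  rw [abs_neg, ofReal_neg, mul_neg, ← sub_eq_add_neg] at hsub
  calc
    1 + t ^ 2 ≤ (1 + |t|) * (1 + |t|) := by nlinarith [sq_abs t, abs_nonneg t]
    _ ≤ _ := mul_le_mul hsub hadd (by positivity) (by positivity)
    _ = _ := by rw [sq_add_sq_eq_sub_I_mul_mul_add_I_mul, norm_mul]; ring

lemma integrable_inv_sq_add_sq {a : ℂ} (ha : a.re ≠ 0) :
    Integrable fun t : ℝ => (a ^ 2 + (t : ℂ) ^ 2)⁻¹ := by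
  have hcont : Continuous fun t : ℝ => (a ^ 2 + (t : ℂ) ^ 2)⁻¹ :=
    Continuous.inv₀ (by fun_prop) (sq_add_sq_ne_zero ha)
  refine (integrable_inv_one_add_sq.const_mul ((1 + (1 + ‖a‖) / |a.re|) ^ 2)).mono'
    hcont.aestronglyMeasurable (ae_of_all _ fun t => ?_)
  rw [norm_inv, ← div_eq_mul_inv, le_div_iff₀ (by positivity),
    inv_mul_le_iff₀ (norm_pos_iff.2 (sq_add_sq_ne_zero ha t)), mul_comm]
  exact one_add_sq_le_mul_norm_sq_add_sq ha t

lemma exp_mul_mul_exp_neg_mul_abs_eqOn_Ioi (c α : ℂ) :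
    Set.EqOn (fun v : ℝ => exp (c * v) * exp (-α * |v|)) (fun v => exp ((c - α) * v))
      (Set.Ioi 0) := by
  intro v hv
  simp only [abs_of_pos (Set.mem_Ioi.1 hv), ← exp_add]
  ring_nf

lemma exp_mul_mul_exp_neg_mul_abs_eqOn_Iic (c α : ℂ) :
    Set.EqOn (fun v : ℝ => exp (c * v) * exp (-α * |v|)) (fun v => exp ((c + α) * v))
      (Set.Iic 0) := by
  intro v hv
  simp only [abs_of_nonpos (Set.mem_Iic.1 hv), ← exp_add, ofReal_neg]
  ring_nf

lemma integrable_exp_mul_mul_exp_neg_mul_abs {c α : ℂ} (h : |c.re| < α.re) :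
    Integrable fun v : ℝ => exp (c * v) * exp (-α * |v|) := by
  obtain ⟨h₁, h₂⟩ := abs_lt.1 h
  rw [← integrableOn_univ, ← Set.Iic_union_Ioi (a := (0 : ℝ)), integrableOn_union]
  constructor
  · exact (integrableOn_exp_mul_complex_Iic (by rw [add_re]; linarith) 0).congr_fun
      (exp_mul_mul_exp_neg_mul_abs_eqOn_Iic c α).symm measurableSet_Iic
  · exact (integrableOn_exp_mul_complex_Ioi (by rw [sub_re]; linarith) 0).congr_fun
      (exp_mul_mul_exp_neg_mul_abs_eqOn_Ioi c α).symm measurableSet_Ioi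

lemma integral_exp_mul_mul_exp_neg_mul_abs {c α : ℂ} (h : |c.re| < α.re) :
    ∫ v : ℝ, exp (c * v) * exp (-α * |v|) = 2 * α / (α ^ 2 - c ^ 2) := by
  obtain ⟨h₁, h₂⟩ := abs_lt.1 h
  have hadd : 0 < (c + α).re := by rw [add_re]; linarith
  have hsub : (c - α).re < 0 := by rw [sub_re]; linarith
  have hadd_ne : c + α ≠ 0 := fun h0 => by simp [h0] at hadd
  have hsub_ne : c - α ≠ 0 := fun h0 => by simp [h0] at hsub
  have hint := integrable_exp_mul_mul_exp_neg_mul_abs h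
  calc
    _ = (∫ v : ℝ in Set.Iic 0, exp ((c + α) * v)) + ∫ v : ℝ in Set.Ioi 0, exp ((c - α) * v) := by
      rw [← intervalIntegral.integral_Iic_add_Ioi hint.integrableOn hint.integrableOn,
        setIntegral_congr_fun measurableSet_Iic (exp_mul_mul_exp_neg_mul_abs_eqOn_Iic c α),
        setIntegral_congr_fun measurableSet_Ioi (exp_mul_mul_exp_neg_mul_abs_eqOn_Ioi c α)]
    _ = 1 / (c + α) - 1 / (c - α) := by
      rw [integral_exp_mul_complex_Iic hadd, integral_exp_mul_complex_Ioi hsub]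
      simp only [ofReal_zero, mul_zero, exp_zero]
      ring
    _ = 2 * α / (α ^ 2 - c ^ 2) := by
      rw [show α ^ 2 - c ^ 2 = -((c + α) * (c - α)) by ring]
      field_simp
      ring

lemma fourier_exp_neg_mul_abs {α : ℂ} (hα : 0 < α.re) (w : ℝ) :
    𝓕 (fun v : ℝ => exp (-α * |v|)) w = 2 * α * (α ^ 2 + ((2 * π * w : ℝ) : ℂ) ^ 2)⁻¹ := by
  have hlaplace := integral_exp_mul_mul_exp_neg_mul_abs (c := -((2 * π * w : ℝ) : ℂ) * I)
    (α := α) (by simpa using hα)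
  rw [mul_pow, I_sq, neg_sq, mul_neg_one, sub_neg_eq_add] at hlaplace
  rw [Real.fourier_real_eq_integral_exp_smul, ← div_eq_mul_inv, ← hlaplace]
  congr 1 with v
  rw [smul_eq_mul]
  congr 2
  push_cast
  ring

lemma fourierInv_fourier_exp_neg_mul_abs {α : ℂ} (hα : 0 < α.re) (u : ℝ) :
    𝓕⁻ (𝓕 fun v : ℝ => exp (-α * |v|)) u = exp (-α * |u|) := by
  refine Integrable.fourierInv_fourier_eq ?_ ?_ (by fun_prop)
  · simpa using integrable_exp_mul_mul_exp_neg_mul_abs (c := 0) (by simpa using hα)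
  · rw [funext (fourier_exp_neg_mul_abs hα)]
    exact ((integrable_inv_sq_add_sq hα.ne').comp_mul_left' Real.two_pi_pos.ne').const_mul _

lemma integral_exp_mul_inv_sq_add_sq {α : ℂ} (hα : 0 < α.re) (u : ℝ) :
    ∫ t : ℝ, exp (I * t * u) * (α ^ 2 + (t : ℂ) ^ 2)⁻¹ = π / α * exp (-α * |u|) := by
  have hα0 : α ≠ 0 := fun h => by simp [h] at hα
  have hinv : exp (-α * |u|) = ∫ w : ℝ, 2 * α *
      (exp (I * (2 * π * w : ℝ) * u) * (α ^ 2 + ((2 * π * w : ℝ) : ℂ) ^ 2)⁻¹) := by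
    rw [← fourierInv_fourier_exp_neg_mul_abs hα, Real.fourierInv_eq',
      funext (fourier_exp_neg_mul_abs hα)]
    congr 1 with w
    have hexponent : ((2 * π * inner ℝ w u : ℝ) : ℂ) * I = I * (2 * π * w : ℝ) * u := by
      simp only [RCLike.inner_apply, conj_trivial]
      push_cast
      ring
    rw [hexponent, smul_eq_mul]
    ring
  rw [integral_const_mul, Measure.integral_comp_mul_left
    (fun t : ℝ => exp (I * t * u) * (α ^ 2 + (t : ℂ) ^ 2)⁻¹),
    abs_of_pos (inv_pos.2 Real.two_pi_pos), real_smul] at hinv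
  rw [hinv]
  generalize (∫ t : ℝ, exp (I * t * u) * (α ^ 2 + (t : ℂ) ^ 2)⁻¹) = fourierIntegral
  push_cast
  field_simp

lemma one_sub_sigmoid_pos (s : ℝ) : 0 < 1 - Real.sigmoid s :=
  sub_pos.2 (Real.sigmoid_lt_one s)

lemma sigmoid_mul_one_sub_sigmoid_pos (s : ℝ) : 0 < Real.sigmoid s * (1 - Real.sigmoid s) :=
  mul_pos (Real.sigmoid_pos s) (one_sub_sigmoid_pos s)

lemma sigmoid_mul_one_sub_sigmoid_le_one (s : ℝ) : Real.sigmoid s * (1 - Real.sigmoid s) ≤ 1 :=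
  mul_le_one₀ (Real.sigmoid_le_one s) (one_sub_sigmoid_pos s).le
    (sub_le_self 1 (Real.sigmoid_nonneg s))

lemma log_sigmoid_sub_log_one_sub_sigmoid (s : ℝ) :
    Real.log (Real.sigmoid s) - Real.log (1 - Real.sigmoid s) = s := by
  rw [← Real.sigmoid_neg, ← Real.sigmoid_mul_rexp_neg,
    Real.log_mul (Real.sigmoid_pos s).ne' (Real.exp_ne_zero _), Real.log_exp]
  ring

lemma abs_deriv_sigmoid_smul_beta_integrand (u v : ℂ) (s : ℝ) :
    |Real.sigmoid s * (1 - Real.sigmoid s)| •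
      ((Real.sigmoid s : ℂ) ^ (u - 1) * (1 - (Real.sigmoid s : ℂ)) ^ (v - 1)) =
      (Real.sigmoid s : ℂ) ^ u * ((1 - Real.sigmoid s : ℝ) : ℂ) ^ v := by
  have hx : (Real.sigmoid s : ℂ) ≠ 0 := ofReal_ne_zero.2 (Real.sigmoid_pos s).ne'
  have hy : (1 - (Real.sigmoid s : ℂ)) ≠ 0 := by
    exact_mod_cast (one_sub_sigmoid_pos s).ne'
  rw [abs_of_pos (sigmoid_mul_one_sub_sigmoid_pos s), real_smul, cpow_sub _ _ hx,
    cpow_sub _ _ hy, cpow_one, cpow_one]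
  push_cast
  field_simp

lemma betaIntegral_eq_integral_sigmoid (u v : ℂ) :
    betaIntegral u v =
      ∫ s : ℝ, (Real.sigmoid s : ℂ) ^ u * ((1 - Real.sigmoid s : ℝ) : ℂ) ^ v := by
  rw [betaIntegral, intervalIntegral.integral_of_le zero_le_one, integral_Ioc_eq_integral_Ioo,
    ← Real.range_sigmoid, ← Set.image_univ,
    integral_image_eq_integral_abs_deriv_smul MeasurableSet.univ
      (fun s _ => (Real.hasDerivAt_sigmoid s).hasDerivWithinAt) Real.sigmoid_injective.injOn,
    setIntegral_univ]
  simp_rw [abs_deriv_sigmoid_smul_beta_integrand]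

lemma integrable_sigmoid_cpow_mul_one_sub_sigmoid_cpow {u v : ℂ} (hu : 0 < u.re)
    (hv : 0 < v.re) :
    Integrable fun s : ℝ => (Real.sigmoid s : ℂ) ^ u * ((1 - Real.sigmoid s : ℝ) : ℂ) ^ v := by
  have h := betaIntegral_convergent hu hv
  rw [intervalIntegrable_iff_integrableOn_Ioo_of_le zero_le_one, ← Real.range_sigmoid,
    ← Set.image_univ, integrableOn_image_iff_integrableOn_abs_deriv_smul MeasurableSet.univ
      (fun s _ => (Real.hasDerivAt_sigmoid s).hasDerivWithinAt) Real.sigmoid_injective.injOn,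
    integrableOn_univ] at h
  simpa only [abs_deriv_sigmoid_smul_beta_integrand] using h

/-- The function `s ↦ (2 cosh (s / 2)) ^ (-2 b)`, encoded as `(σ(s) (1 - σ(s))) ^ b` with the
sigmoid function `σ`: it is what the substitution `x = σ(s)` makes of the integrand of the beta
integral `B(b, b)`. -/
noncomputable def sechPow (b : ℂ) (s : ℝ) : ℂ :=
  ((Real.sigmoid s * (1 - Real.sigmoid s) : ℝ) : ℂ) ^ b

lemma norm_sechPow (b : ℂ) (s : ℝ) :
    ‖sechPow b s‖ = (Real.sigmoid s * (1 - Real.sigmoid s)) ^ b.re :=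
  norm_cpow_eq_rpow_re_of_pos (sigmoid_mul_one_sub_sigmoid_pos s) b

lemma norm_sechPow_le_of_re_le {b c : ℂ} (h : c.re ≤ b.re) (s : ℝ) :
    ‖sechPow b s‖ ≤ ‖sechPow c s‖ := by
  rw [norm_sechPow, norm_sechPow]
  exact Real.rpow_le_rpow_of_exponent_ge (sigmoid_mul_one_sub_sigmoid_pos s)
    (sigmoid_mul_one_sub_sigmoid_le_one s) h

lemma continuous_sechPow (b : ℂ) : Continuous (sechPow b) :=
  (continuous_ofReal.comp (continuous_sigmoid.mul (continuous_const.sub continuous_sigmoid))).cpow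
    continuous_const fun s => ofReal_mem_slitPlane.2 (sigmoid_mul_one_sub_sigmoid_pos s)

lemma continuous_sechPow_left (s : ℝ) : Continuous fun b => sechPow b s :=
  continuous_const.cpow continuous_id fun _ =>
    ofReal_mem_slitPlane.2 (sigmoid_mul_one_sub_sigmoid_pos s)

lemma sigmoid_cpow_add_mul_one_sub_sigmoid_cpow_sub (b c : ℂ) (s : ℝ) :
    (Real.sigmoid s : ℂ) ^ (b + c) * ((1 - Real.sigmoid s : ℝ) : ℂ) ^ (b - c) =
      sechPow b s * exp (c * s) := by
  have hx := Real.sigmoid_pos s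
  have hy := one_sub_sigmoid_pos s
  have hlog : ((Real.log (Real.sigmoid s) : ℝ) : ℂ) - (Real.log (1 - Real.sigmoid s) : ℝ) = s :=
    mod_cast log_sigmoid_sub_log_one_sub_sigmoid s
  rw [sechPow, ofReal_mul, mul_cpow_ofReal_nonneg hx.le hy.le,
    cpow_def_of_ne_zero (ofReal_ne_zero.2 hx.ne'), cpow_def_of_ne_zero (ofReal_ne_zero.2 hy.ne'),
    cpow_def_of_ne_zero (ofReal_ne_zero.2 hx.ne'), cpow_def_of_ne_zero (ofReal_ne_zero.2 hy.ne'),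
    ← ofReal_log hx.le, ← ofReal_log hy.le, ← exp_add, ← exp_add, ← exp_add]
  congr 1
  linear_combination c * hlog

lemma integrable_sechPow_mul_exp {b c : ℂ} (h : |c.re| < b.re) :
    Integrable fun s : ℝ => sechPow b s * exp (c * s) := by
  obtain ⟨h₁, h₂⟩ := abs_lt.1 h
  simpa only [sigmoid_cpow_add_mul_one_sub_sigmoid_cpow_sub] using
    integrable_sigmoid_cpow_mul_one_sub_sigmoid_cpow (u := b + c) (v := b - c)
      (by rw [add_re]; linarith) (by rw [sub_re]; linarith)

lemma integrable_sechPow {b : ℂ} (hb : 0 < b.re) : Integrable (sechPow b) := by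
  simpa using integrable_sechPow_mul_exp (b := b) (c := 0) (by simpa using hb)

lemma Gamma_add_mul_Gamma_sub {b c : ℂ} (h : |c.re| < b.re) :
    Gamma (b + c) * Gamma (b - c) = Gamma (2 * b) * ∫ s : ℝ, sechPow b s * exp (c * s) := by
  obtain ⟨h₁, h₂⟩ := abs_lt.1 h
  rw [Gamma_mul_Gamma_eq_betaIntegral (by rw [add_re]; linarith) (by rw [sub_re]; linarith),
    betaIntegral_eq_integral_sigmoid]
  simp_rw [sigmoid_cpow_add_mul_one_sub_sigmoid_cpow_sub]
  ring_nf

lemma continuousAt_Gamma_of_re_pos {z : ℂ} (hz : 0 < z.re) : ContinuousAt Gamma z := by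
  refine continuousAt_Gamma z fun m hm => hz.not_ge ?_
  simp [hm]

lemma norm_exp_I_mul_mul (t s : ℝ) : ‖exp (I * t * s)‖ = 1 := by
  simp [norm_exp]

lemma Gamma_sub_I_mul_mul_Gamma_add_I_mul {b : ℂ} (hb : 0 < b.re) (t : ℝ) :
    Gamma (b - I * t) * Gamma (b + I * t) =
      Gamma (2 * b) * ∫ s : ℝ, sechPow b s * exp (I * t * s) := by
  rw [mul_comm, Gamma_add_mul_Gamma_sub (by simpa using hb)]

lemma norm_Gamma_sub_I_mul_mul_Gamma_add_I_mul_le {b : ℂ} (hb : 0 < b.re) (t : ℝ) :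
    ‖Gamma (b - I * t) * Gamma (b + I * t)‖ ≤ ‖Gamma (2 * b)‖ * ∫ s : ℝ, ‖sechPow b s‖ := by
  rw [Gamma_sub_I_mul_mul_Gamma_add_I_mul hb, norm_mul]
  gcongr
  refine (norm_integral_le_integral_norm _).trans_eq ?_
  simp_rw [norm_mul, norm_exp_I_mul_mul, mul_one]

lemma continuous_Gamma_sub_I_mul_mul_Gamma_add_I_mul {b : ℂ} (hb : 0 < b.re) :
    Continuous fun t : ℝ => Gamma (b - I * t) * Gamma (b + I * t) := by
  refine continuous_iff_continuousAt.2 fun t => ContinuousAt.mul ?_ ?_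
  · exact (continuousAt_Gamma_of_re_pos (by simpa using hb)).comp
      (f := fun t : ℝ => b - I * t) (by fun_prop)
  · exact (continuousAt_Gamma_of_re_pos (by simpa using hb)).comp
      (f := fun t : ℝ => b + I * t) (by fun_prop)

lemma exp_mul_ofReal_sub (c : ℂ) (s ξ : ℝ) :
    exp (c * (s - ξ : ℝ)) = exp (c * s) * exp (-(c * ξ)) := by
  rw [← exp_add, ofReal_sub, mul_sub, sub_eq_add_neg]

/-- The convolution of `sechPow b` with the kernel `v ↦ e^{-α|v|}`, evaluated at `ξ`. -/
noncomputable def sechPowConv (b α : ℂ) (ξ : ℝ) : ℂ :=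
  ∫ s : ℝ, sechPow b s * exp (-α * |s - ξ|)

lemma integrable_sechPow_mul_exp_mul_sub {b c : ℂ} (h : |c.re| < b.re) (ξ : ℝ) :
    Integrable fun s : ℝ => sechPow b s * exp (c * (s - ξ : ℝ)) := by
  simp_rw [exp_mul_ofReal_sub, ← mul_assoc]
  exact (integrable_sechPow_mul_exp h).mul_const _

lemma Gamma_two_mul_mul_integral_sechPow_mul_exp_mul_sub {b c : ℂ} (h : |c.re| < b.re) (ξ : ℝ) :
    Gamma (2 * b) * ∫ s : ℝ, sechPow b s * exp (c * (s - ξ : ℝ)) =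
      Gamma (b + c) * Gamma (b - c) * exp (-(c * ξ)) := by
  simp_rw [exp_mul_ofReal_sub, ← mul_assoc]
  rw [Gamma_add_mul_Gamma_sub h, mul_assoc, ← integral_mul_const]

lemma integrable_sechPow_mul_exp_neg_mul_abs_sub {b α : ℂ} (h : |α.re| < b.re) (ξ : ℝ) :
    Integrable fun s : ℝ => sechPow b s * exp (-α * |s - ξ|) := by
  have hpos := integrable_sechPow_mul_exp_mul_sub h ξ
  have hneg := integrable_sechPow_mul_exp_mul_sub (c := -α) (by simpa using h) ξ
  refine (hpos.norm.add hneg.norm).mono'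
    ((continuous_sechPow b).mul (by fun_prop)).aestronglyMeasurable (ae_of_all _ fun s => ?_)
  rcases abs_choice (s - ξ) with hs | hs
  · simp only [hs, Pi.add_apply]
    exact le_add_of_nonneg_left (norm_nonneg _)
  · simp only [hs, ofReal_neg, neg_mul_neg, Pi.add_apply]
    exact le_add_of_nonneg_right (norm_nonneg _)

lemma norm_sechPow_mul_exp_neg_mul_abs_sub_le {b c α β : ℂ} (hb : c.re ≤ b.re)
    (hα : β.re ≤ α.re) (s ξ : ℝ) :
    ‖sechPow b s * exp (-α * |s - ξ|)‖ ≤ ‖sechPow c s * exp (-β * |s - ξ|)‖ := by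
  simp only [norm_mul, norm_exp, re_mul_ofReal, neg_re]
  gcongr
  exact norm_sechPow_le_of_re_le hb s

lemma continuousAt_sechPowConv {b α : ℂ} (h : |α.re| < b.re) (ξ : ℝ) :
    ContinuousAt (fun q : ℂ × ℂ => sechPowConv q.1 q.2 ξ) (b, α) := by
  obtain ⟨r, hαr, hrb⟩ := exists_between h
  obtain ⟨β, hrβ, hβb⟩ := exists_between hrb
  have hr : 0 < r := (abs_nonneg _).trans_lt hαr
  have hβ_lt : ∀ᶠ q : ℂ × ℂ in 𝓝 (b, α), β < q.1.re :=
    (continuous_re.comp continuous_fst).continuousAt.eventually_const_lt hβb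
  have hr_lt : ∀ᶠ q : ℂ × ℂ in 𝓝 (b, α), -r < q.2.re :=
    (continuous_re.comp continuous_snd).continuousAt.eventually_const_lt (abs_lt.1 hαr).1
  refine continuousAt_of_dominated
    (bound := fun s => ‖sechPow β s * exp (-((-r : ℝ) : ℂ) * |s - ξ|)‖)
    (Eventually.of_forall fun q =>
      ((continuous_sechPow q.1).mul (by fun_prop)).aestronglyMeasurable) ?_
    (integrable_sechPow_mul_exp_neg_mul_abs_sub ?_ ξ).norm (ae_of_all _ fun s => ?_)
  · filter_upwards [hβ_lt, hr_lt] with q hq₁ hq₂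
    exact ae_of_all _ fun s => norm_sechPow_mul_exp_neg_mul_abs_sub_le hq₁.le hq₂.le s ξ
  · simpa [abs_of_pos hr] using hrβ
  · exact (((continuous_sechPow_left s).comp continuous_fst).mul (by fun_prop)).continuousAt

lemma exp_neg_mul_abs_add_exp_mul_abs (α : ℂ) (x : ℝ) :
    exp (-α * |x|) + exp (α * |x|) = exp (α * x) + exp (-α * x) := by
  rcases abs_choice x with h | h <;> rw [h]
  · exact add_comm _ _
  · simp

lemma Gamma_two_mul_mul_sechPowConv_add {b α : ℂ} (h : |α.re| < b.re) (ξ : ℝ) :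
    Gamma (2 * b) * (sechPowConv b α ξ + sechPowConv b (-α) ξ) =
      2 * cosh (α * ξ) * (Gamma (b + α) * Gamma (b - α)) := by
  have h' : |(-α).re| < b.re := by simpa using h
  have hsum : sechPowConv b α ξ + sechPowConv b (-α) ξ =
      (∫ s : ℝ, sechPow b s * exp (α * (s - ξ : ℝ))) +
        ∫ s : ℝ, sechPow b s * exp (-α * (s - ξ : ℝ)) := by
    rw [sechPowConv, sechPowConv,
      ← integral_add (integrable_sechPow_mul_exp_neg_mul_abs_sub h ξ)
        (integrable_sechPow_mul_exp_neg_mul_abs_sub h' ξ),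
      ← integral_add (integrable_sechPow_mul_exp_mul_sub h ξ)
        (integrable_sechPow_mul_exp_mul_sub h' ξ)]
    simp_rw [← mul_add, neg_neg, exp_neg_mul_abs_add_exp_mul_abs]
  rw [hsum, mul_add, Gamma_two_mul_mul_integral_sechPow_mul_exp_mul_sub h,
    Gamma_two_mul_mul_integral_sechPow_mul_exp_mul_sub h', two_cosh, ← sub_eq_add_neg,
    sub_neg_eq_add, neg_mul, neg_neg]
  ring

/-- The continuation of `α ↦ ∫ Γ(b - it) Γ(b + it) (α² + t²)⁻¹ e^{-itξ} dt` from `0 < re α` to the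
strip `|re α| < re b`, punctured at `α = 0`. For `-1 < re a`, it represents `J(a, ξ)` with
`b = a + 1` and `α` the one of `±a` with positive real part. -/
noncomputable def gammaBranch (b α : ℂ) (ξ : ℝ) : ℂ :=
  Gamma (2 * b) * (π / α) * sechPowConv b α ξ

lemma continuousAt_gammaBranch {b α : ℂ} (h : |α.re| < b.re) (hα : α ≠ 0) (ξ : ℝ) :
    ContinuousAt (fun q : ℂ × ℂ => gammaBranch q.1 q.2 ξ) (b, α) := by
  have hb : 0 < (2 * b).re := by simpa using (abs_nonneg _).trans_lt h
  have hGamma : ContinuousAt (fun q : ℂ × ℂ => Gamma (2 * q.1)) (b, α) :=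
    (continuousAt_Gamma_of_re_pos hb).comp (f := fun q : ℂ × ℂ => 2 * q.1) (by fun_prop)
  exact (hGamma.mul (continuousAt_const.div continuousAt_snd hα)).mul
    (continuousAt_sechPowConv h ξ)

lemma gammaBranch_sub_gammaBranch_neg {b α : ℂ} (h : |α.re| < b.re) (ξ : ℝ) :
    gammaBranch b α ξ - gammaBranch b (-α) ξ =
      2 * π / α * cosh (α * ξ) * (Gamma (b + α) * Gamma (b - α)) := by
  rw [gammaBranch, gammaBranch, div_neg]
  linear_combination π / α * Gamma_two_mul_mul_sechPowConv_add h ξ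

lemma integral_inv_sq_add_sq_mul_sechPow_mul_exp {b α : ℂ} (hα : 0 < α.re) (s ξ : ℝ) :
    ∫ t : ℝ, (α ^ 2 + (t : ℂ) ^ 2)⁻¹ * sechPow b s * exp (I * t * (s - ξ : ℝ)) =
      π / α * (sechPow b s * exp (-α * |s - ξ|)) := by
  rw [mul_left_comm, ← integral_exp_mul_inv_sq_add_sq hα, ← integral_const_mul]
  congr 1 with t
  ring

lemma integral_Gamma_mul_Gamma_mul_inv_sq_add_sq {b α : ℂ} (hb : 0 < b.re) (hα : 0 < α.re)
    (ξ : ℝ) :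
    ∫ t : ℝ, Gamma (b - I * t) * Gamma (b + I * t) *
      ((α ^ 2 + (t : ℂ) ^ 2)⁻¹ * exp (-(I * t * ξ))) = gammaBranch b α ξ := by
  have hprod : Integrable (Function.uncurry fun t s : ℝ =>
      (α ^ 2 + (t : ℂ) ^ 2)⁻¹ * sechPow b s * exp (I * t * (s - ξ : ℝ)))
      (volume.prod volume) :=
    ((integrable_inv_sq_add_sq hα.ne').mul_prod (integrable_sechPow hb)).mul_bdd (c := 1)
      (Continuous.aestronglyMeasurable (by fun_prop))
      (ae_of_all _ fun x => (norm_exp_I_mul_mul _ _).le)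
  calc
    _ = ∫ t : ℝ, Gamma (2 * b) * ∫ s : ℝ,
        (α ^ 2 + (t : ℂ) ^ 2)⁻¹ * sechPow b s * exp (I * t * (s - ξ : ℝ)) := by
      congr 1 with t
      rw [Gamma_sub_I_mul_mul_Gamma_add_I_mul hb, mul_assoc, ← integral_mul_const]
      congr 2 with s
      rw [exp_mul_ofReal_sub]
      ring
    _ = Gamma (2 * b) * ∫ s : ℝ, ∫ t : ℝ,
        (α ^ 2 + (t : ℂ) ^ 2)⁻¹ * sechPow b s * exp (I * t * (s - ξ : ℝ)) := by
      rw [integral_const_mul, integral_integral_swap hprod]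
    _ = gammaBranch b α ξ := by
      simp_rw [integral_inv_sq_add_sq_mul_sechPow_mul_exp hα]
      rw [integral_const_mul, ← mul_assoc, gammaBranch, sechPowConv]

lemma gammaIntegrand_eq_mul_inv_sq_add_sq {a : ℂ} (ha : a.re ≠ 0) (ξ t : ℝ) :
    gammaIntegrand a ξ t = Gamma (a + 1 - I * t) * Gamma (a + 1 + I * t) *
      ((a ^ 2 + (t : ℂ) ^ 2)⁻¹ * exp (-(I * t * ξ))) := by
  have hsub := sub_I_mul_ne_zero ha t
  have hadd := add_I_mul_ne_zero ha t
  rw [gammaIntegrand, sq_add_sq_eq_sub_I_mul_mul_add_I_mul, add_sub_right_comm, add_right_comm,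
    Gamma_add_one _ hsub, Gamma_add_one _ hadd]
  field_simp

lemma integrable_gammaIntegrand {a : ℂ} (ha : -1 < a.re) (ha0 : a.re ≠ 0) (ξ : ℝ) :
    Integrable (gammaIntegrand a ξ) := by
  have hb : 0 < (a + 1).re := by rw [add_re, one_re]; linarith
  have hkernel : Integrable fun t : ℝ => (a ^ 2 + (t : ℂ) ^ 2)⁻¹ * exp (-(I * t * ξ)) :=
    (integrable_inv_sq_add_sq ha0).mul_bdd (c := 1) (by fun_prop)
      (ae_of_all _ fun t => by simp [norm_exp])
  rw [funext (gammaIntegrand_eq_mul_inv_sq_add_sq ha0 ξ)]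
  exact hkernel.bdd_mul (continuous_Gamma_sub_I_mul_mul_Gamma_add_I_mul hb).aestronglyMeasurable
    (ae_of_all _ (norm_Gamma_sub_I_mul_mul_Gamma_add_I_mul_le hb))

lemma J_eq_gammaBranch_of_re_pos {a : ℂ} (ha : 0 < a.re) (ξ : ℝ) :
    J a ξ = gammaBranch (a + 1) a ξ := by
  rw [J, funext (gammaIntegrand_eq_mul_inv_sq_add_sq ha.ne' ξ)]
  exact integral_Gamma_mul_Gamma_mul_inv_sq_add_sq (by rw [add_re, one_re]; linarith) ha ξ

lemma J_eq_gammaBranch_of_re_neg {a : ℂ} (ha : -1 < a.re) (ha0 : a.re < 0) (ξ : ℝ) :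
    J a ξ = gammaBranch (a + 1) (-a) ξ := by
  rw [J, funext (gammaIntegrand_eq_mul_inv_sq_add_sq ha0.ne ξ), ← neg_sq a]
  exact integral_Gamma_mul_Gamma_mul_inv_sq_add_sq (by rw [add_re, one_re]; linarith)
    (by rwa [neg_re, neg_pos]) ξ

lemma tendsto_J_nhdsWithin_re_pos {p : ℂ} (hp : |p.re| < (p + 1).re) (hp0 : p ≠ 0) (ξ : ℝ) :
    Tendsto (fun a => J a ξ) (𝓝[{a : ℂ | 0 < a.re}] p) (𝓝 (gammaBranch (p + 1) p ξ)) := by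
  have hcont : ContinuousAt (fun a => gammaBranch (a + 1) a ξ) p :=
    (continuousAt_gammaBranch hp hp0 ξ).comp (f := fun a => (a + 1, a)) (by fun_prop)
  refine (hcont.tendsto.mono_left nhdsWithin_le_nhds).congr' ?_
  filter_upwards [self_mem_nhdsWithin] with a ha
  exact (J_eq_gammaBranch_of_re_pos ha ξ).symm

lemma tendsto_J_nhdsWithin_re_neg {p : ℂ} (hp : |p.re| < (p + 1).re) (hp0 : p ≠ 0) (ξ : ℝ) :
    Tendsto (fun a => J a ξ) (𝓝[{a : ℂ | a.re < 0}] p) (𝓝 (gammaBranch (p + 1) (-p) ξ)) := by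
  have hcont : ContinuousAt (fun a => gammaBranch (a + 1) (-a) ξ) p :=
    (continuousAt_gammaBranch (by simpa using hp) (neg_ne_zero.2 hp0) ξ).comp
      (f := fun a => (a + 1, -a)) (by fun_prop)
  have hre : -1 < p.re := by
    rw [add_re, one_re] at hp
    linarith [abs_nonneg p.re]
  refine (hcont.tendsto.mono_left nhdsWithin_le_nhds).congr' ?_
  filter_upwards [self_mem_nhdsWithin, nhdsWithin_le_nhds
    (continuous_re.continuousAt.eventually_const_lt hre)] with a ha0 ha
  exact (J_eq_gammaBranch_of_re_neg ha ha0 ξ).symm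

lemma gammaBranch_add_one_sub_gammaBranch_neg {p : ℂ} (hp : |p.re| < (p + 1).re) (hp0 : p ≠ 0)
    (ξ : ℝ) :
    gammaBranch (p + 1) p ξ - gammaBranch (p + 1) (-p) ξ =
      4 * π * cosh (p * ξ) * Gamma (2 * p) := by
  rw [gammaBranch_sub_gammaBranch_neg hp, add_sub_cancel_left, Gamma_one, add_right_comm,
    ← two_mul, Gamma_add_one _ (mul_ne_zero two_ne_zero hp0)]
  field_simp
  ring

end

theorem corollary3 (ξ : ℝ) (p : ℂ) (hp_re : p.re = 0) (hp : p ≠ 0) :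
    (∀ a : ℂ, -1 < a.re → a.re ≠ 0 → Integrable (gammaIntegrand a ξ) volume) ∧
    HasJumpAcrossImaginaryAxis (fun a => J a ξ) p
      (4 * (Real.pi : ℂ) * Complex.cosh (p * ξ) * Complex.Gamma (2 * p)) := by
  have hp_strip : |p.re| < (p + 1).re := by simp [hp_re]
  exact ⟨fun a ha ha0 => integrable_gammaIntegrand ha ha0 ξ,
    gammaBranch (p + 1) p ξ, gammaBranch (p + 1) (-p) ξ,
    tendsto_J_nhdsWithin_re_pos hp_strip hp ξ,
    tendsto_J_nhdsWithin_re_neg hp_strip hp ξ,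
    gammaBranch_add_one_sub_gammaBranch_neg hp_strip hp ξ⟩
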